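/- Let $\mathbb{O}=\mathbb{H}\oplus\mathbb{H}\ell$ be the real octonion division algebra, with product $(q+r\ell)(s+t\ell)=(qs-\overline{t}r)+(tq+r\overline{s})\ell$ for $q,r,s,t\in\mathbb{H}$, and let $\mathbb{O}[x]=\mathbb{O}\otimes_{\mathbb{R}}\mathbb{R}[x]$ be the algebra of octonion polynomials, in which the indeterminate $x$ commutes and associates with everything. Then every $f(x)\in\mathbb{O}[x]$ decomposes as a product of a constant and linear factors: if $n$ is the degree of $f$ and $c\in\mathbb{O}$ its leading coefficient (with $n=0$ and $c=0$ for $f=0$), there are $\lambda_1,\dots,\lambda_n\in\mathbb{O}$ such that $$f(x)=((\dots(c(x-\lambda_n))\dots(x-\lambda_3))(x-\lambda_2))(x-\lambda_1),$$ where for $n=0$ the right-hand side is read as the constant polynomial $c$. -/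

import Mathlib

/-- The real octonions `𝕆 = ℍ ⊕ ℍ ℓ`, the Cayley-Dickson double with `γ = -1` of Hamilton's
quaternions; `⟨q, r⟩` stands for `q + r ℓ`. -/
@[ext]
structure Octonion where
  fst : Quaternion ℝ
  snd : Quaternion ℝ

namespace Octonion

noncomputable instance : Zero Octonion := ⟨⟨0, 0⟩⟩
noncomputable instance : One Octonion := ⟨⟨1, 0⟩⟩
noncomputable instance : Add Octonion := ⟨fun a b => ⟨a.fst + b.fst, a.snd + b.snd⟩⟩
noncomputable instance : Neg Octonion := ⟨fun a => ⟨-a.fst, -a.snd⟩⟩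
noncomputable instance : Sub Octonion := ⟨fun a b => ⟨a.fst - b.fst, a.snd - b.snd⟩⟩

/-- The Cayley-Dickson product
`(q + r ℓ) (s + t ℓ) = (q s - star t * r) + (t q + r * star s) ℓ`. -/
noncomputable instance : Mul Octonion :=
  ⟨fun a b => ⟨a.fst * b.fst - star b.snd * a.snd, b.snd * a.fst + a.snd * star b.fst⟩⟩

noncomputable instance : SMul ℝ Octonion := ⟨fun r a => ⟨r • a.fst, r • a.snd⟩⟩

@[simp] theorem fst_zero : (0 : Octonion).fst = 0 := rfl
@[simp] theorem snd_zero : (0 : Octonion).snd = 0 := rfl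
@[simp] theorem fst_one : (1 : Octonion).fst = 1 := rfl
@[simp] theorem snd_one : (1 : Octonion).snd = 0 := rfl
@[simp] theorem fst_add (a b : Octonion) : (a + b).fst = a.fst + b.fst := rfl
@[simp] theorem snd_add (a b : Octonion) : (a + b).snd = a.snd + b.snd := rfl
@[simp] theorem fst_neg (a : Octonion) : (-a).fst = -a.fst := rfl
@[simp] theorem snd_neg (a : Octonion) : (-a).snd = -a.snd := rfl
@[simp] theorem fst_sub (a b : Octonion) : (a - b).fst = a.fst - b.fst := rfl
@[simp] theorem snd_sub (a b : Octonion) : (a - b).snd = a.snd - b.snd := rfl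
@[simp] theorem fst_mul (a b : Octonion) :
    (a * b).fst = a.fst * b.fst - star b.snd * a.snd := rfl
@[simp] theorem snd_mul (a b : Octonion) :
    (a * b).snd = b.snd * a.fst + a.snd * star b.fst := rfl
@[simp] theorem fst_smul (r : ℝ) (a : Octonion) : (r • a).fst = r • a.fst := rfl
@[simp] theorem snd_smul (r : ℝ) (a : Octonion) : (r • a).snd = r • a.snd := rfl

noncomputable instance : AddCommGroup Octonion where
  add_assoc a b c := by ext1 <;> simp only [fst_add, snd_add, add_assoc]
  zero_add a := by ext1 <;> simp only [fst_add, snd_add, fst_zero, snd_zero, zero_add]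
  add_zero a := by ext1 <;> simp only [fst_add, snd_add, fst_zero, snd_zero, add_zero]
  neg_add_cancel a := by
    ext1 <;> simp only [fst_add, snd_add, fst_neg, snd_neg, fst_zero, snd_zero, neg_add_cancel]
  sub_eq_add_neg a b := by
    ext1 <;> simp only [fst_add, snd_add, fst_neg, snd_neg, fst_sub, snd_sub, sub_eq_add_neg]
  add_comm a b := by ext1 <;> simp only [fst_add, snd_add, add_comm]
  nsmul := nsmulRec
  zsmul := zsmulRec

noncomputable instance : NonAssocRing Octonion where
  left_distrib a b c := by
    ext1 <;> simp only [fst_add, snd_add, fst_mul, snd_mul, star_add, mul_add, add_mul] <;> abel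
  right_distrib a b c := by
    ext1 <;> simp only [fst_add, snd_add, fst_mul, snd_mul, mul_add, add_mul] <;> abel
  zero_mul a := by ext1 <;> simp only [fst_mul, snd_mul, fst_zero, snd_zero, zero_mul, mul_zero,
    sub_zero, add_zero]
  mul_zero a := by ext1 <;> simp only [fst_mul, snd_mul, fst_zero, snd_zero, zero_mul, mul_zero,
    star_zero, sub_zero, add_zero]
  one_mul a := by ext1 <;> simp only [fst_mul, snd_mul, fst_one, snd_one, one_mul, mul_zero,
    mul_one, zero_mul, sub_zero, add_zero]
  mul_one a := by ext1 <;> simp only [fst_mul, snd_mul, fst_one, snd_one, mul_one, zero_mul,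
    star_zero, star_one, sub_zero, zero_add]

noncomputable instance : Module ℝ Octonion where
  one_smul a := by ext1 <;> simp only [fst_smul, snd_smul, one_smul]
  mul_smul r s a := by ext1 <;> simp only [fst_smul, snd_smul, mul_smul]
  smul_zero r := by ext1 <;> simp only [fst_smul, snd_smul, fst_zero, snd_zero, smul_zero]
  smul_add r a b := by ext1 <;> simp only [fst_smul, snd_smul, fst_add, snd_add, smul_add]
  add_smul r s a := by ext1 <;> simp only [fst_smul, snd_smul, fst_add, snd_add, add_smul]
  zero_smul a := by ext1 <;> simp only [fst_smul, snd_smul, fst_zero, snd_zero, zero_smul]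

instance : IsScalarTower ℝ Octonion Octonion where
  smul_assoc r a b := by
    ext1 <;> simp only [smul_eq_mul, fst_smul, snd_smul, fst_mul, snd_mul, smul_mul_assoc,
      mul_smul_comm, smul_sub, smul_add]

instance : SMulCommClass ℝ Octonion Octonion where
  smul_comm r a b := by
    ext1 <;> simp only [smul_eq_mul, fst_smul, snd_smul, fst_mul, snd_mul, smul_mul_assoc,
      mul_smul_comm, smul_sub, smul_add, Quaternion.star_smul]

end Octonion

/-- The polynomial algebra `𝕆[x] = 𝕆 ⊗ ℝ[x]` over the octonions, with the product
`(a ⊗ p) (b ⊗ q) = a b ⊗ p q`: the indeterminate is central and associates with everything. -/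
abbrev OctonionPoly : Type := TensorProduct ℝ Octonion (Polynomial ℝ)

namespace OctonionPoly

/-- The constant polynomial `c`. -/
noncomputable def const (c : Octonion) : OctonionPoly :=
  TensorProduct.tmul ℝ c (1 : Polynomial ℝ)

/-- The indeterminate `x`. -/
noncomputable def x : OctonionPoly :=
  TensorProduct.tmul ℝ (1 : Octonion) (Polynomial.X : Polynomial ℝ)

/-- The coefficient of `x ^ k`: the real-linear map sending `a ⊗ p` to `(p.coeff k) • a`. -/
noncomputable def coeff (k : ℕ) : OctonionPoly →ₗ[ℝ] Octonion :=
  (TensorProduct.rid ℝ Octonion).toLinearMap ∘ₗ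
    LinearMap.lTensor Octonion (Polynomial.lcoeff ℝ k)

theorem coeff_tmul (k : ℕ) (a : Octonion) (p : Polynomial ℝ) :
    coeff k (TensorProduct.tmul ℝ a p) = p.coeff k • a := by
  simp [coeff]

theorem finite_support (f : OctonionPoly) : {k : ℕ | coeff k f ≠ 0}.Finite := by
  induction f using TensorProduct.induction_on with
  | zero => simp
  | tmul a p =>
    refine p.support.finite_toSet.subset fun k hk => ?_
    simp only [Set.mem_ofPred_eq, coeff_tmul] at hk
    simpa using left_ne_zero_of_smul hk
  | add f g hf hg =>
    refine (hf.union hg).subset fun k hk => ?_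
    simp only [Set.mem_ofPred_eq, map_add, Set.mem_union] at hk ⊢
    by_contra! h
    exact hk (by rw [h.1, h.2, add_zero])

/-- The degree of `f`, the largest `k` such that `x ^ k` has a nonzero coefficient in `f`
(with value `0` for `f = 0`). -/
noncomputable def natDegree (f : OctonionPoly) : ℕ := sSup {k : ℕ | coeff k f ≠ 0}

/-- The leading coefficient of `f` (with value `0` for `f = 0`). -/
noncomputable def leadingCoeff (f : OctonionPoly) : Octonion := coeff (natDegree f) f

/-- The nested product `((…(c (x - l_n))…)(x - l_2))(x - l_1)`, where `l_i` is `l (i - 1)`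
in the indexing by `Fin n`; the empty product (`n = 0`) is the constant polynomial `c`. -/
noncomputable def nestedProd (c : Octonion) : (n : ℕ) → (Fin n → Octonion) → OctonionPoly
  | 0, _ => const c
  | n + 1, l => nestedProd c n (fun i => l i.succ) * (x - const (l 0))

end OctonionPoly

/-! Induct on the degree, splitting off a right factor `x - b` at each step. Since `(a * b ^ k) * b
= a * b ^ (k + 1)` despite nonassociativity, Horner division by `x - b` works whenever `∑ c k * b ^
k = 0`, so all rests on finding such a root `b` (`exists_root`). The squares of the eight real
coordinate polynomials of `f` sum to a real polynomial with a complex root `z`. If `z` is real, it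
is a root of `f`. Otherwise, on octonions `b` with real part `z.re` and norm `|z|^2`, powers reduce
as those of `z` do, so `f` takes the value `E * b + G` with `E`, `G` fixed. The vanishing at `z`
gives exactly the inner products that put `-E⁻¹ * G` among these `b`. -/

namespace Octonion

/-! ### Norm and quadratic identities -/

/-- The coordinates of an octonion in the standard real basis. -/
noncomputable def coord (a : Octonion) : Fin 8 → ℝ :=
  ![a.fst.re, a.fst.imI, a.fst.imJ, a.fst.imK, a.snd.re, a.snd.imI, a.snd.imJ, a.snd.imK]

theorem coord_injective : Function.Injective coord := fun a b h => by
  ext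
  exacts [congrFun h 0, congrFun h 1, congrFun h 2, congrFun h 3, congrFun h 4, congrFun h 5,
    congrFun h 6, congrFun h 7]

/-- The coordinates as a linear map. -/
noncomputable def coordₗ : Octonion →ₗ[ℝ] (Fin 8 → ℝ) where
  toFun := coord
  map_add' a b := by ext i; fin_cases i <;> simp [coord]
  map_smul' r a := by ext i; fin_cases i <;> simp [coord]

theorem coord_zero : coord 0 = 0 := map_zero coordₗ

/-- The Euclidean inner product of octonions. -/
noncomputable def dot (a b : Octonion) : ℝ := ∑ i, coord a i * coord b i

theorem dot_one (a : Octonion) : dot 1 a = a.fst.re := by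
  have h : coord 1 = ![1, 0, 0, 0, 0, 0, 0, 0] := rfl
  rw [dot, h]
  simp [coord, Fin.sum_univ_succ]

theorem dot_self_eq_zero {a : Octonion} : dot a a = 0 ↔ a = 0 := by
  constructor
  · intro h
    refine coord_injective (coord_zero ▸ funext fun i => ?_)
    exact mul_self_eq_zero.1
      ((Finset.sum_eq_zero_iff_of_nonneg fun i _ => mul_self_nonneg _).1 h i (Finset.mem_univ i))
  · rintro rfl
    simp [dot, coord_zero]

/-- Octonion conjugation. -/
noncomputable def conj (a : Octonion) : Octonion := ⟨star a.fst, -a.snd⟩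

theorem mul_conj_mul (a b : Octonion) : a * (conj a * b) = dot a a • b := by
  ext <;> simp [conj, dot, coord, Fin.sum_univ_succ] <;> ring

theorem dot_conj_mul_self (a b : Octonion) :
    dot (conj a * b) (conj a * b) = dot a a * dot b b := by
  simp [conj, dot, coord, Fin.sum_univ_succ]; ring

theorem dot_one_conj_mul (a b : Octonion) : dot 1 (conj a * b) = dot a b := by
  rw [dot_one]
  simp [conj, dot, coord, Fin.sum_univ_succ]; ring

theorem dot_smul_smul (r s : ℝ) (a b : Octonion) : dot (r • a) (s • b) = r * s * dot a b := by
  simp [dot, coord, Fin.sum_univ_succ]; ring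

/-- Right alternativity combined with the quadratic equation `b ^ 2 = 2 Re(b) b - |b|^2`; the only
substitute for associativity used below. -/
theorem mul_mul_self (a b : Octonion) :
    (a * b) * b = (2 * dot 1 b) • (a * b) - dot b b • a := by
  rw [dot_one]
  ext <;> simp [dot, coord, Fin.sum_univ_succ] <;> ring

/-- Right multiplication by `b` on the products of `a` with elements of the plane `ℝ b + ℝ`,
reduced by the quadratic equation of `b`. -/
theorem mul_linear_combination_mul (a b : Octonion) (u v : ℝ) :
    (a * (u • b + v • 1)) * b = a * ((2 * dot 1 b * u + v) • b + (-(dot b b) * u) • 1) := by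
  simp only [mul_add, add_mul, mul_smul_comm, smul_mul_assoc, mul_mul_self, mul_one]
  module

/-! ### Existence of roots -/

/-- A sum of squares of real polynomials, not all constant, has a complex root. -/
theorem exists_complex_sum_sq_eq_zero {ι : Type*} [Fintype ι] (n : ℕ) (v : ℕ → ι → ℝ)
    (hv : v (n + 1) ≠ 0) :
    ∃ z : ℂ, ∑ i, (∑ k ∈ Finset.range (n + 2), (v k i : ℂ) * z ^ k) ^ 2 = 0 := by
  open Polynomial in
  let p : ι → ℝ[X] := fun i => ∑ k ∈ Finset.range (n + 2), C (v k i) * X ^ k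
  let q : ℝ[X] := ∑ i, p i ^ 2
  have hdeg : ∀ i, (p i).natDegree ≤ n + 1 := fun i =>
    natDegree_sum_le_of_forall_le _ _ fun k hk =>
      (natDegree_C_mul_X_pow_le _ _).trans (by grind)
  have hp : ∀ i, (p i).coeff (n + 1) = v (n + 1) i := fun i => by
    simp [p, finsetSum_coeff, coeff_X_pow]
  -- The top coefficients are real squares, so they cannot cancel.
  have hq : q.coeff ((n + 1) * 2) = ∑ i, v (n + 1) i ^ 2 := by
    simp only [q, finsetSum_coeff]
    refine Finset.sum_congr rfl fun i _ => ?_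
    rw [mul_comm, coeff_pow_of_natDegree_le (hdeg i), hp]
  have hne : q.coeff ((n + 1) * 2) ≠ 0 := by
    rw [hq]
    intro h
    refine hv (funext fun i => ?_)
    exact pow_eq_zero_iff two_ne_zero |>.1
      ((Finset.sum_eq_zero_iff_of_nonneg fun i _ => sq_nonneg _).1 h i (Finset.mem_univ i))
  have hq0 : (q.map (algebraMap ℝ ℂ)).degree ≠ 0 := by
    rw [degree_map]
    intro h
    have hle := le_natDegree_of_ne_zero hne
    have h0 : q.natDegree = 0 := natDegree_eq_of_degree_eq_some h
    omega
  obtain ⟨z, hz⟩ := Complex.isAlgClosed.exists_root _ hq0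
  refine ⟨z, ?_⟩
  simpa [q, p, IsRoot, Polynomial.eval_finsetSum, Polynomial.map_sum, Polynomial.eval_map] using hz

/-- Every nonconstant octonion polynomial `∑ c k x ^ k` has a root `b`; here `w k` plays the
role of `b ^ k`. -/
theorem exists_root (n : ℕ) (c : ℕ → Octonion) (hc : c (n + 1) ≠ 0) :
    ∃ (b : Octonion) (w : ℕ → Octonion), w 0 = 1 ∧ (∀ k a, (a * w k) * b = a * w (k + 1)) ∧
      ∑ k ∈ Finset.range (n + 2), c k * w k = 0 := by
  obtain ⟨z, hz⟩ := exists_complex_sum_sq_eq_zero n (fun k => coord (c k))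
    (fun h => hc (coord_injective (h.trans coord_zero.symm)))
  have hcoord : ∀ (s : ℕ → ℝ) i, coord (∑ k ∈ Finset.range (n + 2), s k • c k) i =
      ∑ k ∈ Finset.range (n + 2), s k * coord (c k) i := fun s i => by
    change coordₗ _ i = _
    simp only [map_sum, map_smul, Finset.sum_apply, Pi.smul_apply, smul_eq_mul]
    rfl
  by_cases hb : z.im = 0
  · obtain ⟨r, rfl⟩ : ∃ r : ℝ, (r : ℂ) = z := ⟨z.re, Complex.ext rfl hb.symm⟩
    refine ⟨r • 1, fun k => r ^ k • 1, by simp, fun k a => by simp [pow_succ', smul_smul], ?_⟩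
    simp only [mul_smul_comm, mul_one]
    rw [← dot_self_eq_zero]
    simp only [dot, hcoord]
    rw [← Complex.ofReal_eq_zero, ← hz]
    push_cast
    exact Finset.sum_congr rfl fun i _ => by simp only [mul_comm, sq]
  -- The remainder of `X ^ k` modulo the real minimal polynomial of `z` is `u k * X + v k`.
  · let u : ℕ → ℝ := fun k => (z ^ k).im / z.im
    let v : ℕ → ℝ := fun k => (z ^ k).re - z.re * u k
    have huv : ∀ k, z ^ k = u k * z + v k := fun k => by
      apply Complex.ext <;> simp [u, v] <;> field_simp
      ring
    have hu : ∀ k, u (k + 1) = 2 * z.re * u k + v k := fun k => by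
      simp only [u, v, pow_succ, Complex.mul_im]; field_simp; ring
    have hv : ∀ k, v (k + 1) = -(z.re ^ 2 + z.im ^ 2) * u k := fun k => by
      simp only [u, v, pow_succ, Complex.mul_im, Complex.mul_re]; field_simp; ring
    set E := ∑ k ∈ Finset.range (n + 2), u k • c k with hE
    set G := ∑ k ∈ Finset.range (n + 2), v k • c k with hG
    have hsum : ∀ b : Octonion,
        ∑ k ∈ Finset.range (n + 2), c k * (u k • b + v k • 1) = E * b + G := fun b => by
      simp only [mul_add, mul_smul_comm, mul_one, Finset.sum_add_distrib, hE, hG, Finset.sum_mul,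
        smul_mul_assoc]
    have hquad : (dot E E : ℂ) * z ^ 2 + 2 * dot E G * z + dot G G = 0 := by
      rw [← hz]
      simp only [dot, Complex.ofReal_sum, Complex.ofReal_mul, Finset.sum_mul, Finset.mul_sum,
        ← Finset.sum_add_distrib]
      refine Finset.sum_congr rfl fun i _ => ?_
      have : ∑ k ∈ Finset.range (n + 2), (coord (c k) i : ℂ) * z ^ k = coord E i * z + coord G i := by
        rw [hE, hG, hcoord, hcoord]
        push_cast
        rw [Finset.sum_mul, ← Finset.sum_add_distrib]
        exact Finset.sum_congr rfl fun k _ => by rw [huv]; ring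
      rw [this]; ring
    have him := congrArg Complex.im hquad
    have hre := congrArg Complex.re hquad
    simp [sq] at him hre
    -- A real quadratic vanishing at the nonreal `z` is a multiple of its minimal polynomial.
    have hEG : dot E G = -z.re * dot E E := by
      apply mul_right_cancel₀ hb; linarith
    have hGG : dot G G = (z.re ^ 2 + z.im ^ 2) * dot E E := by
      rw [hEG] at hre; linarith
    suffices ∃ b : Octonion, dot 1 b = z.re ∧ dot b b = z.re ^ 2 + z.im ^ 2 ∧ E * b + G = 0 by
      obtain ⟨b, hb1, hb2, hb3⟩ := this
      refine ⟨b, fun k => u k • b + v k • 1, by simp [u, v], fun k a => ?_, (hsum b).trans hb3⟩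
      rw [mul_linear_combination_mul, hb1, hb2, ← hu, ← hv]
    by_cases hE0 : E = 0
    · have hG0 : G = 0 := dot_self_eq_zero.1 (by rw [hGG, dot_self_eq_zero.2 hE0, mul_zero])
      -- Every `b` with the prescribed real part and norm is a root here; take the copy of `z` in a
      -- complex subfield.
      refine ⟨⟨⟨z.re, z.im, 0, 0⟩, ⟨0, 0, 0, 0⟩⟩, dot_one _, ?_,
        by rw [hE0, hG0, zero_mul, add_zero]⟩
      simp [dot, coord, Fin.sum_univ_succ, sq]
    · have hEE : dot E E ≠ 0 := mt dot_self_eq_zero.1 hE0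
      -- This is `-E⁻¹ * G`.
      refine ⟨(-(dot E E)⁻¹) • (conj E * G), ?_, ?_, ?_⟩
      · rw [← one_smul ℝ (1 : Octonion), dot_smul_smul, dot_one_conj_mul, hEG]; field_simp
      · rw [dot_smul_smul, dot_conj_mul_self, hGG]; field_simp
      · rw [mul_smul_comm, mul_conj_mul, smul_smul, neg_mul, inv_mul_cancel₀ hEE, neg_one_smul,
          neg_add_cancel]

end Octonion

/-! ### Right division and factorization -/

namespace OctonionPoly

open TensorProduct Polynomial

theorem exists_eq_sum_coeff (f : OctonionPoly) :
    ∃ N, ∀ M ≥ N, f = ∑ k ∈ Finset.range M, coeff k f ⊗ₜ[ℝ] (X ^ k : ℝ[X]) := by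
  induction f using TensorProduct.induction_on with
  | zero => exact ⟨0, fun M _ => by simp⟩
  | tmul a p =>
    refine ⟨p.natDegree + 1, fun M hM => ?_⟩
    simp only [coeff_tmul, smul_tmul, ← tmul_sum]
    congr 1
    simpa only [smul_eq_C_mul] using p.as_sum_range_C_mul_X_pow' hM
  | add f g hf hg =>
    obtain ⟨N₁, h₁⟩ := hf
    obtain ⟨N₂, h₂⟩ := hg
    refine ⟨max N₁ N₂, fun M hM => ?_⟩
    simp only [map_add, add_tmul, Finset.sum_add_distrib]
    rw [← h₁ M (le_trans (le_max_left _ _) hM), ← h₂ M (le_trans (le_max_right _ _) hM)]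

theorem coeff_eq_zero_of_natDegree_lt {f : OctonionPoly} {k : ℕ} (hk : natDegree f < k) :
    coeff k f = 0 := by
  by_contra h
  exact hk.not_ge (le_csSup (finite_support f).bddAbove h)

theorem leadingCoeff_ne_zero {f : OctonionPoly} (hf : natDegree f ≠ 0) : leadingCoeff f ≠ 0 := by
  have hne : {k : ℕ | coeff k f ≠ 0}.Nonempty := by
    by_contra h
    rw [Set.not_nonempty_iff_eq_empty] at h
    exact hf (by rw [natDegree, h, csSup_empty, Nat.bot_eq_zero])
  exact Nat.sSup_mem hne (finite_support f).bddAbove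

theorem eq_sum_coeff (f : OctonionPoly) :
    f = ∑ k ∈ Finset.range (natDegree f + 1), coeff k f ⊗ₜ[ℝ] (X ^ k : ℝ[X]) := by
  obtain ⟨N, hN⟩ := exists_eq_sum_coeff f
  refine (hN _ (le_max_left N (natDegree f + 1))).trans (Finset.sum_subset ?_ ?_).symm
  · exact Finset.range_mono (le_max_right _ _)
  · intro k _ hk
    rw [coeff_eq_zero_of_natDegree_lt (by simpa using hk), zero_tmul]

theorem sum_mul_x_sub_const (n : ℕ) (g : ℕ → Octonion) (b : Octonion) :
    (∑ k ∈ Finset.range n, g k ⊗ₜ[ℝ] (X ^ k : ℝ[X]) : OctonionPoly) * (x - const b) =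
      ∑ k ∈ Finset.range n, g k ⊗ₜ[ℝ] (X ^ (k + 1) : ℝ[X]) -
        ∑ k ∈ Finset.range n, (g k * b) ⊗ₜ[ℝ] (X ^ k : ℝ[X]) := by
  simp only [mul_sub, Finset.sum_mul, x, const, Algebra.TensorProduct.tmul_mul_tmul, mul_one,
    pow_succ]

/-- A nonconstant octonion polynomial is divisible on the right by a monic linear one. -/
theorem exists_eq_mul_x_sub_const (n : ℕ) (c : ℕ → Octonion) (hc : c (n + 1) ≠ 0) :
    ∃ (b : Octonion) (g : ℕ → Octonion), g n = c (n + 1) ∧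
      (∑ k ∈ Finset.range (n + 2), c k ⊗ₜ[ℝ] (X ^ k : ℝ[X]) : OctonionPoly) =
        (∑ k ∈ Finset.range (n + 1), g k ⊗ₜ[ℝ] (X ^ k : ℝ[X])) * (x - const b) := by
  obtain ⟨b, w, hw0, hw, hroot⟩ := Octonion.exists_root n c hc
  -- Horner coefficients of the quotient, with `w k` as `b ^ k`; the sum is empty at `j = n + 1`.
  let g : ℕ → Octonion := fun j => ∑ k ∈ Finset.range (n + 1 - j), c (k + j + 1) * w k
  have hgb : ∀ j, g j * b = ∑ k ∈ Finset.range (n + 1 - j), c (k + 1 + j) * w (k + 1) :=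
    fun j => by simp only [g, Finset.sum_mul, hw, add_right_comm]
  have hg : ∀ j ≤ n, c (j + 1) = g j - g (j + 1) * b := fun j hj => by
    rw [hgb, eq_sub_iff_add_eq]
    simp only [g]
    rw [show n + 1 - j = (n + 1 - (j + 1)) + 1 by omega, Finset.sum_range_succ', hw0, mul_one,
      zero_add, add_comm]
    simp only [add_assoc]
  have hg0 : c 0 = -(g 0 * b) := by
    rw [eq_neg_iff_add_eq_zero, hgb, ← hroot, Finset.sum_range_succ', hw0, mul_one, add_comm]
    rfl
  have hgn : g (n + 1) = 0 := by simp [g]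
  refine ⟨b, g, by rw [hg n le_rfl, hgn, zero_mul, sub_zero], ?_⟩
  have hlast : ∑ k ∈ Finset.range (n + 1), (g k * b) ⊗ₜ[ℝ] (X ^ k : ℝ[X]) =
      ∑ k ∈ Finset.range (n + 2), (g k * b) ⊗ₜ[ℝ] (X ^ k : ℝ[X]) := by
    rw [Finset.sum_range_succ _ (n + 1), hgn, zero_mul, zero_tmul, add_zero]
  rw [sum_mul_x_sub_const, hlast, Finset.sum_range_succ', Finset.sum_range_succ' _ (n + 1), hg0,
    neg_tmul, ← sub_sub, ← sub_eq_add_neg, ← Finset.sum_sub_distrib]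
  congr 1
  refine Finset.sum_congr rfl fun k hk => ?_
  rw [hg k (by grind), sub_tmul]

/-- A monic right factor leaves the top coefficient unchanged, so the induction keeps it nonzero; a
constant may be zero. -/
theorem exists_sum_eq_nestedProd (n : ℕ) (c : ℕ → Octonion) (hc : n ≠ 0 → c n ≠ 0) :
    ∃ l : Fin n → Octonion,
      (∑ k ∈ Finset.range (n + 1), c k ⊗ₜ[ℝ] (X ^ k : ℝ[X]) : OctonionPoly) =
        nestedProd (c n) n l := by
  induction n generalizing c with
  | zero => exact ⟨Fin.elim0, by simp [nestedProd, const]⟩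
  | succ n ih =>
    have hc := hc n.succ_ne_zero
    obtain ⟨b, g, hgn, h⟩ := exists_eq_mul_x_sub_const n c hc
    obtain ⟨l, hl⟩ := ih g fun _ => hgn ▸ hc
    exact ⟨Fin.cons b l, by simp only [nestedProd, Fin.cons_zero, Fin.cons_succ, h, hl, hgn]⟩

end OctonionPoly

theorem mainTheorem4 (f : OctonionPoly) :
    ∃ l : Fin (OctonionPoly.natDegree f) → Octonion,
      f = OctonionPoly.nestedProd (OctonionPoly.leadingCoeff f) (OctonionPoly.natDegree f) l := by
  obtain ⟨l, hl⟩ := OctonionPoly.exists_sum_eq_nestedProd (OctonionPoly.natDegree f)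
    (fun k => OctonionPoly.coeff k f) OctonionPoly.leadingCoeff_ne_zero
  exact ⟨l, (OctonionPoly.eq_sum_coeff f).trans hl⟩
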